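/- Conventions. Let $n\ge 1$ and let $Q$ be a quiver whose set of arrows is partitioned into $n+1$ nonempty parts, called arrow types. The type of a path $\gamma$ is the function counting its arrows of each arrow type; $\gamma$ is admissible if it contains no arrow of a certain type, and simple if it contains at most one arrow of each type. A simple path is maximal if it is not a proper part of a longer simple path. $Q$ is a $\mathbb Z^n$-quiver if: (1) exactly one arrow of each type leaves each vertex; (2) each vertex is connected to each other vertex by an admissible path; (3) each maximal simple path is a circuit (maximal simple paths are then called minimal circuits); (4) two admissible paths leaving the same vertex arrive at the same vertex if and only if they are of the same type. Distinct vertices $u_1,u_2$ are neighbors if there is an admissible simple path from $u_1$ to $u_2$. A polygon is a finite nonempty set of pairwise neighboring vertices. Let $k$ be a field and $\mathcal A$ a $k$-linear abelian category. For a representation $\mathfrak V$ of $Q$ in $\mathcal A$, let $V_v$ be the object at the vertex $v$ and $\varphi_\gamma$ the composition of the maps along the path $\gamma$ (the identity if $\gamma$ is trivial). $\mathfrak V$ is a linked net if: (1) if $\gamma_1,\gamma_2$ are paths connecting the same two vertices and $\gamma_2$ is admissible, then $\varphi_{\gamma_1}$ is a scalar multiple of $\varphi_{\gamma_2}$; (2)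 $\varphi_\gamma=0$ for each minimal circuit $\gamma$; (3) if $\gamma_1,\gamma_2$ are admissible paths leaving the same vertex with no arrow type in common, then $\operatorname{Ker}(\varphi_{\gamma_1})\cap\operatorname{Ker}(\varphi_{\gamma_2})=0$. A linked net is exact if $\operatorname{Ker}(\varphi_\gamma)=\operatorname{Im}(\varphi_\mu)$ for all neighboring vertices $u_1,u_2$ and all admissible paths $\gamma$ from $u_1$ to $u_2$ and $\mu$ from $u_2$ to $u_1$. It is simple if each $V_v$ is a simple object, and locally finite if for each vertex $v$ there is an integer $\ell$ such that $\varphi_\mu=0$ for every path $\mu$ arriving at $v$ of length greater than $\ell$. $\mathfrak V$ is generated by a set $H$ of vertices if for each vertex $v$ there are finitely many $w_1,\dots,w_m\in H$ (not necessarily distinct) and paths $\mu_i$ from $w_i$ to $v$ such that $(\varphi_{\mu_1},\dots,\varphi_{\mu_m})\colon\bigoplus_i V_{w_i}\to V_v$ is an epimorphism. An abelian category is semisimple if each of its objects is a finite direct sum of simple objects. Proposition. Let $\mathfrak V$ be an exact linked net over a $\mathbb Z^n$-quiver $Q$ of objects in a $k$-linear semisimple abelian category. If $\mathfrak V$ is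 generated by a polygon, then $\mathfrak V$ is isomorphic, as a representation of $Q$, to a finite (possibly empty) direct sum of simple locally finite exact linked nets over $Q$. -/

import Mathlib

open CategoryTheory CategoryTheory.Limits

universe u₁ u₂ v₁ v₂ w

attribute [local instance] CategoryTheory.Abelian.hasFiniteBiproducts

/-! ### Quivers with typed arrows and `ℤⁿ`-quivers -/

/-- A partition of the set of arrows of a quiver into `n + 1` nonempty parts, encoded by the
function sending each arrow to (the label of) the part containing it, its *type*. -/
structure ArrowPartition (Q : Type u₁) [Quiver.{v₁} Q] (n : ℕ) where
  /-- The type of an arrow. -/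
  type : ∀ ⦃a b : Q⦄, (a ⟶ b) → Fin (n + 1)
  /-- The parts are nonempty. -/
  exists_type_eq : ∀ t : Fin (n + 1), ∃ (a b : Q) (e : a ⟶ b), type e = t

namespace ArrowPartition

variable {Q : Type u₁} [Quiver.{v₁} Q] {n : ℕ} (P : ArrowPartition Q n)

/-- The type of a path: the number of its arrows of each given type. -/
def pathType : ∀ {a b : Q}, Quiver.Path a b → Fin (n + 1) → ℕ
  | _, _, .nil, _ => 0
  | _, _, .cons p e, t => pathType p t + if P.type e = t then 1 else 0

/-- A path is admissible if it contains no arrow of a certain type. -/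
def IsAdmissible {a b : Q} (γ : Quiver.Path a b) : Prop :=
  ∃ t, P.pathType γ t = 0

/-- A path is simple if it contains at most one arrow of each type. -/
def IsSimplePath {a b : Q} (γ : Quiver.Path a b) : Prop :=
  ∀ t, P.pathType γ t ≤ 1

/-- A simple path is maximal (a *minimal circuit*, in a `ℤⁿ`-quiver) if it is not a proper part
of a simple path. -/
def IsMaximalSimplePath {a b : Q} (γ : Quiver.Path a b) : Prop :=
  P.IsSimplePath γ ∧
    ∀ ⦃a' b' : Q⦄ (α : Quiver.Path a' a) (β : Quiver.Path b b'),
      P.IsSimplePath ((α.comp γ).comp β) → α.length = 0 ∧ β.length = 0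

/-- The partition gives the quiver a `ℤⁿ`-structure. -/
structure IsZnStructure : Prop where
  pos : 0 < n
  /-- Exactly one arrow of each type leaves each vertex. -/
  existsUnique_arrow : ∀ (a : Q) (t : Fin (n + 1)), ∃! e : (Σ b : Q, a ⟶ b), P.type e.2 = t
  /-- Each vertex is connected to each other by an admissible path. -/
  exists_admissible : ∀ a b : Q, a ≠ b → ∃ γ : Quiver.Path a b, P.IsAdmissible γ
  /-- Each maximal simple path is a circuit. -/
  circuit : ∀ ⦃a b : Q⦄ (γ : Quiver.Path a b), P.IsMaximalSimplePath γ → a = b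
  /-- Admissible paths with the same source have the same target iff they have the same type. -/
  target_eq_iff : ∀ ⦃a b c : Q⦄ (γ₁ : Quiver.Path a b) (γ₂ : Quiver.Path a c),
    P.IsAdmissible γ₁ → P.IsAdmissible γ₂ → (b = c ↔ P.pathType γ₁ = P.pathType γ₂)

/-- Two distinct vertices are neighbors if an admissible simple path connects the first to the
second. -/
def Neighbors (a b : Q) : Prop :=
  a ≠ b ∧ ∃ γ : Quiver.Path a b, P.IsAdmissible γ ∧ P.IsSimplePath γ

/-- A polygon is a finite nonempty collection of pairwise neighboring vertices. -/
def IsPolygon (H : Set Q) : Prop :=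
  H.Finite ∧ H.Nonempty ∧ H.Pairwise P.Neighbors

end ArrowPartition

/-! ### Representations of quivers -/

/-- A category is semisimple if each object is a finite direct sum of simple objects. -/
def IsSemisimpleCategory (C : Type u₂) [Category.{v₂} C] [Abelian C] : Prop :=
  ∀ X : C, ∃ (m : ℕ) (S : Fin m → C), (∀ i, Simple (S i)) ∧ Nonempty (X ≅ ⨁ S)

/-- Representations of the quiver `Q` in `C`, as functors from the category of paths of `Q`.
Maps of representations are natural transformations. -/
abbrev QuiverRep (Q : Type u₁) [Quiver.{v₁} Q] (C : Type u₂) [Category.{v₂} C] :=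
  Paths Q ⥤ C

namespace QuiverRep

variable {Q : Type u₁} [Quiver.{v₁} Q] {C : Type u₂} [Category.{v₂} C]

/-- The object associated to a vertex. -/
abbrev vertexObj (V : QuiverRep Q C) (a : Q) : C :=
  V.obj ((Paths.of Q).obj a)

/-- The composition of the maps associated to the arrows of a path (the identity for a trivial
path). -/
abbrev pathMap (V : QuiverRep Q C) {a b : Q} (γ : Quiver.Path a b) :
    V.vertexObj a ⟶ V.vertexObj b :=
  V.map (X := (Paths.of Q).obj a) (Y := (Paths.of Q).obj b) γ

/-- Each associated object is simple. -/
def IsSimpleRep [HasZeroMorphisms C] (V : QuiverRep Q C) : Prop :=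
  ∀ a : Q, Simple (V.vertexObj a)

/-- For each vertex, the maps of all long enough paths arriving at it vanish. -/
def IsLocallyFinite [HasZeroMorphisms C] (V : QuiverRep Q C) : Prop :=
  ∀ b : Q, ∃ l : ℕ, ∀ (a : Q) (γ : Quiver.Path a b), l < γ.length → V.pathMap γ = 0

variable [Abelian C]

/-- `V` is generated by `H` if each associated object is the target of an epimorphism from a
finite direct sum of objects associated to vertices in `H` (repetitions allowed), given by maps
associated to paths. -/
def IsGeneratedBy (V : QuiverRep Q C) (H : Set Q) : Prop :=
  ∀ b : Q, ∃ (m : ℕ) (a : Fin m → Q) (γ : ∀ i, Quiver.Path (a i) b),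
    (∀ i, a i ∈ H) ∧
      Epi (biproduct.desc (f := fun i => V.vertexObj (a i)) fun i => V.pathMap (γ i))

variable {n : ℕ} (P : ArrowPartition Q n)

/-- Weakly linked nets over a quiver with typed arrows, with respect to the field of scalars
`k`. -/
structure IsWeaklyLinkedNet (k : Type w) [Field k] [Linear k C] (V : QuiverRep Q C) : Prop where
  smul_of_admissible : ∀ ⦃a b : Q⦄ (γ₁ γ₂ : Quiver.Path a b), P.IsAdmissible γ₂ →
    ∃ c : k, V.pathMap γ₁ = c • V.pathMap γ₂
  minimal_circuit : ∀ ⦃a b : Q⦄ (γ : Quiver.Path a b), P.IsMaximalSimplePath γ →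
    V.pathMap γ = 0

/-- A linked net is a weakly linked net in which the kernels of the maps associated to two
admissible paths with the same source and no arrow type in common intersect trivially. -/
structure IsLinkedNet (k : Type w) [Field k] [Linear k C] (V : QuiverRep Q C) : Prop
    extends IsWeaklyLinkedNet P k V where
  kernel_inf : ∀ ⦃a b c : Q⦄ (γ₁ : Quiver.Path a b) (γ₂ : Quiver.Path a c),
    P.IsAdmissible γ₁ → P.IsAdmissible γ₂ →
    (∀ t, P.pathType γ₁ t = 0 ∨ P.pathType γ₂ t = 0) →
    kernelSubobject (V.pathMap γ₁) ⊓ kernelSubobject (V.pathMap γ₂) = ⊥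

/-- Exactness. In a weakly linked net the maps associated to the admissible paths between two
given vertices agree up to nonzero scalars, so that the kernel and the image do not depend on the
choice of `γ` and `μ`. -/
def IsExactNet (V : QuiverRep Q C) : Prop :=
  ∀ ⦃a b : Q⦄, P.Neighbors a b → ∀ (γ : Quiver.Path a b) (μ : Quiver.Path b a),
    P.IsAdmissible γ → P.IsAdmissible μ →
    kernelSubobject (V.pathMap γ) = imageSubobject (V.pathMap μ)

end QuiverRep

/-! ### Combinatorics of `ℤⁿ`-quivers -/

namespace ArrowPartition

variable {Q : Type u₁} [Quiver.{v₁} Q] {n : ℕ} {P : ArrowPartition Q n}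

/-! All admissible paths from `a` to `b` have one type, `disp a b`, and any other path has this type
plus a constant: it carries extra circuits. So `disp a b + disp b c = disp a c + m` for some
constant `m`. In a weakly linked net the composite of the maps `a → b → c` is a nonzero multiple of
the map `a → c` if `m = 0`. If `m > 0` it vanishes, since the composite path can be traded for one
containing a minimal circuit (`pathMap_eq_zero`). Questions about composites thus become arithmetic
of displacements.

In a semisimple category, choose at each vertex `h` of the polygon a complement of the sum of the
images coming from the other polygon vertices. The complements, transported to any vertex `v`,
decompose `V_v`. They span (`comb_surjective`), because replacing a vector at `h` by its components
from other polygon vertices either kills its image at `v` or lengthens the displacement to `v`,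
which is bounded on the polygon. They are independent at a polygon vertex, where the polygon's order
by displacement separates them (`eq_zero_of_sum_eq_zero`). Exactness carries independence along each
arrow (`comb_step`), hence to every vertex.

Splitting the complements into simple objects, each simple `S` placed at `h` generates a copy of a
net with constant object `S`, whose maps are nonzero exactly along paths that prolong admissible
paths from `h`. These nets are the summands. -/

@[simp]
theorem pathType_nil (a : Q) (t : Fin (n + 1)) :
    P.pathType (Quiver.Path.nil : Quiver.Path a a) t = 0 := by
  simp only [pathType]

@[simp]
theorem pathType_cons {a b c : Q} (p : Quiver.Path a b) (e : b ⟶ c) (t : Fin (n + 1)) :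
    P.pathType (p.cons e) t = P.pathType p t + if P.type e = t then 1 else 0 := by
  simp only [pathType]

@[simp]
theorem pathType_comp {a b c : Q} (p : Quiver.Path a b) (q : Quiver.Path b c) (t : Fin (n + 1)) :
    P.pathType (p.comp q) t = P.pathType p t + P.pathType q t := by
  induction q with
  | nil => simp
  | cons q e ih => simp [ih, add_assoc]

theorem sum_pathType {a b : Q} (p : Quiver.Path a b) : ∑ t, P.pathType p t = p.length := by
  induction p with
  | nil => simp
  | cons p e ih => simp [Finset.sum_add_distrib, ih]

theorem length_eq_zero_of_pathType {a b : Q} {p : Quiver.Path a b}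
    (h : ∀ t, P.pathType p t = 0) : p.length = 0 := by
  simp [← P.sum_pathType p, h]

theorem isMaximalSimplePath_of_pathType {a b : Q} {p : Quiver.Path a b}
    (h : ∀ t, P.pathType p t = 1) : P.IsMaximalSimplePath p := by
  refine ⟨fun t => (h t).le, fun a' b' α β hs => ⟨?_, ?_⟩⟩ <;>
  · refine P.length_eq_zero_of_pathType fun t => ?_
    have := hs t
    simp only [pathType_comp, h] at this
    omega

namespace IsZnStructure

variable (hP : P.IsZnStructure)
include hP

theorem pathType_of_isMaximalSimplePath {a b : Q} {p : Quiver.Path a b}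
    (h : P.IsMaximalSimplePath p) (t : Fin (n + 1)) : P.pathType p t = 1 := by
  refine le_antisymm (h.1 t) (Nat.one_le_iff_ne_zero.2 fun h0 => ?_)
  obtain ⟨⟨c, e⟩, he, -⟩ := hP.existsUnique_arrow b t
  -- If type `t` were missing, appending the arrow of type `t` would give a longer simple path.
  have := (h.2 Quiver.Path.nil (Quiver.Path.nil.cons e) fun s => by
    have := h.1 s
    by_cases hs : t = s
    · subst hs; simp [h0, show P.type e = t from he]
    · simp [show P.type e = t from he, hs, this]).2
  simp at this

theorem eq_of_pathType_eq_one {a b : Q} {p : Quiver.Path a b}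
    (h : ∀ t, P.pathType p t = 1) : a = b :=
  hP.circuit p (isMaximalSimplePath_of_pathType h)

theorem exists_path (a : Q) (τ : Fin (n + 1) → ℕ) :
    ∃ (b : Q) (γ : Quiver.Path a b), ∀ t, P.pathType γ t = τ t := by
  induction hs : ∑ t, τ t generalizing τ with
  | zero =>
    refine ⟨a, Quiver.Path.nil, fun t => ?_⟩
    simpa using (Finset.sum_eq_zero_iff.1 hs t (Finset.mem_univ t)).symm
  | succ s ih =>
    obtain ⟨t, ht⟩ : ∃ t, τ t ≠ 0 := by
      by_contra! h
      simp [h] at hs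
    have hτ : ∀ u, τ u = (τ u - if t = u then 1 else 0) + if t = u then 1 else 0 := by
      intro u
      split_ifs with h
      · subst h; omega
      · omega
    obtain ⟨b, γ, hγ⟩ := ih (fun u => τ u - if t = u then 1 else 0) (by
      have := Finset.sum_congr rfl fun u (_ : u ∈ Finset.univ) => hτ u
      rw [Finset.sum_add_distrib] at this
      rw [hs, Finset.sum_ite_eq, if_pos (Finset.mem_univ t)] at this
      exact (Nat.succ.inj this).symm)
    obtain ⟨⟨c, e⟩, he, -⟩ := hP.existsUnique_arrow b t
    refine ⟨c, γ.cons e, fun u => ?_⟩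
    rw [pathType_cons, hγ, show P.type e = t from he]
    exact (hτ u).symm

theorem target_eq {a b c : Q} {γ₁ : Quiver.Path a b} {γ₂ : Quiver.Path a c}
    (h₁ : P.IsAdmissible γ₁) (h : ∀ t, P.pathType γ₁ t = P.pathType γ₂ t) : b = c :=
  (hP.target_eq_iff γ₁ γ₂ h₁ (h₁.imp fun t ht => (h t).symm.trans ht)).2 (funext h)

theorem pathType_eq {a b : Q} {γ₁ γ₂ : Quiver.Path a b}
    (h₁ : P.IsAdmissible γ₁) (h₂ : P.IsAdmissible γ₂) : P.pathType γ₁ = P.pathType γ₂ :=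
  (hP.target_eq_iff γ₁ γ₂ h₁ h₂).1 rfl

/-- If an admissible path `p` becomes nonadmissible when prolonged by an arrow `e`, then `p` may be
replaced by a path of the same type whose last part forms a circuit with `e`. -/
theorem exists_circuit_of_cons {a b c : Q} {p : Quiver.Path a b} (e : b ⟶ c)
    (hp : P.IsAdmissible p) (hpe : ¬ P.IsAdmissible (p.cons e)) :
    ∃ (ν : Quiver.Path a c) (μ : Quiver.Path c b),
      (∀ t, P.pathType p t = P.pathType ν t + P.pathType μ t) ∧
      (∀ t, P.pathType (μ.cons e) t = 1) := by
  -- The type of `e` is the only type missing from `p`. Hence one arrow of each other type can be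
  -- split off as `μ`, and `μ` followed by `e` has type `(1, …, 1)`, so is a circuit.
  have h0 : P.pathType p (P.type e) = 0 := by
    obtain ⟨t, ht⟩ := hp
    by_cases h : P.type e = t
    · rw [h, ht]
    · exact (hpe ⟨t, by simp [ht, h]⟩).elim
  have hpos : ∀ t, P.type e ≠ t → P.pathType p t ≠ 0 := fun t ht h =>
    hpe ⟨t, by simp [ht, h]⟩
  obtain ⟨x, ν, hν⟩ := hP.exists_path a fun t => P.pathType p t - if P.type e = t then 0 else 1
  obtain ⟨y, μ, hμ⟩ := hP.exists_path x fun t => if P.type e = t then 0 else 1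
  have hsum : ∀ t, P.pathType p t = P.pathType (ν.comp μ) t := by
    intro t
    rw [pathType_comp, hν, hμ]
    have := hpos t
    split_ifs with h
    · omega
    · have := this h; omega
  obtain rfl := hP.target_eq hp hsum
  have hc : ∀ t, P.pathType (μ.cons e) t = 1 := fun t => by
    rw [pathType_cons, hμ]; split_ifs <;> rfl
  obtain rfl := hP.eq_of_pathType_eq_one hc
  exact ⟨ν, μ, fun t => (hsum t).trans (pathType_comp _ _ _), hc⟩

theorem exists_isAdmissible (a b : Q) : ∃ γ : Quiver.Path a b, P.IsAdmissible γ := by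
  by_cases h : a = b
  · subst h; exact ⟨Quiver.Path.nil, 0, pathType_nil _ _⟩
  · exact hP.exists_admissible a b h

/-- A chosen admissible path between two vertices. -/
noncomputable def path (a b : Q) : Quiver.Path a b :=
  (hP.exists_isAdmissible a b).choose

theorem isAdmissible_path (a b : Q) : P.IsAdmissible (hP.path a b) :=
  (hP.exists_isAdmissible a b).choose_spec

/-- The common type of the admissible paths between two vertices. -/
noncomputable def disp (a b : Q) : Fin (n + 1) → ℕ :=
  P.pathType (hP.path a b)

theorem exists_disp_eq_zero (a b : Q) : ∃ t, hP.disp a b t = 0 :=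
  hP.isAdmissible_path a b

theorem pathType_eq_disp {a b : Q} {γ : Quiver.Path a b} (h : P.IsAdmissible γ)
    (t : Fin (n + 1)) : P.pathType γ t = hP.disp a b t :=
  congrFun (hP.pathType_eq h (hP.isAdmissible_path a b)) t

@[simp]
theorem disp_self (a : Q) (t : Fin (n + 1)) : hP.disp a a t = 0 :=
  (hP.pathType_eq_disp ⟨0, pathType_nil a 0⟩ t).symm.trans (pathType_nil a t)

theorem path_self (a : Q) : hP.path a a = Quiver.Path.nil :=
  Quiver.Path.eq_nil_of_length_zero _
    (P.length_eq_zero_of_pathType fun t => hP.disp_self a t)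

/-- Append arrows one at a time to an admissible path: whenever admissibility is lost, one circuit
splits off, which lowers every count by one and leaves an admissible path. -/
theorem exists_pathType_eq_disp_add {a b : Q} (γ : Quiver.Path a b) :
    ∃ c, ∀ t, P.pathType γ t = hP.disp a b t + c := by
  induction γ with
  | nil => exact ⟨0, by simp⟩
  | @cons b d p e ih =>
    obtain ⟨c, hc⟩ := ih
    by_cases h : P.IsAdmissible ((hP.path a b).cons e)
    · refine ⟨c, fun t => ?_⟩
      rw [← hP.pathType_eq_disp h, pathType_cons, pathType_cons, hc, disp]
      omega
    · obtain ⟨ν, μ, h₁, h₂⟩ := hP.exists_circuit_of_cons e (hP.isAdmissible_path a b) h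
      have hν : P.IsAdmissible ν := (hP.isAdmissible_path a b).imp fun t ht => by
        have := h₁ t; omega
      refine ⟨c + 1, fun t => ?_⟩
      have h₂ := h₂ t
      have h₁ := h₁ t
      rw [pathType_cons] at h₂ ⊢
      rw [← hP.pathType_eq_disp hν, hc, disp]
      omega

theorem exists_disp_add_disp (a b c : Q) :
    ∃ m, ∀ t, hP.disp a b t + hP.disp b c t = hP.disp a c t + m := by
  obtain ⟨m, hm⟩ := hP.exists_pathType_eq_disp_add ((hP.path a b).comp (hP.path b c))
  exact ⟨m, fun t => by rw [← hm, pathType_comp]; rfl⟩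

theorem eq_of_disp_eq_zero {a b : Q} (h : ∀ t, hP.disp a b t = 0) : a = b :=
  Quiver.Path.eq_of_length_zero _ (P.length_eq_zero_of_pathType h)

theorem disp_le_one {a b : Q} (h : P.Neighbors a b) (t : Fin (n + 1)) : hP.disp a b t ≤ 1 := by
  obtain ⟨-, γ, hγ, hs⟩ := h
  exact hP.pathType_eq_disp hγ t ▸ hs t

theorem disp_add_disp_eq_one {a b : Q} (h : P.Neighbors a b) (t : Fin (n + 1)) :
    hP.disp a b t + hP.disp b a t = 1 := by
  have hle := hP.disp_le_one h
  obtain ⟨s, hs⟩ : ∃ s, hP.disp a b s ≠ 0 := by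
    by_contra! h0
    exact h.1 (hP.eq_of_disp_eq_zero h0)
  -- A path of the complementary type closes up to a circuit; it is admissible since it avoids the
  -- type `s`, so its type is `disp b a`.
  obtain ⟨c, γ, hγ⟩ := hP.exists_path b fun t => 1 - hP.disp a b t
  have hc : a = c := hP.eq_of_pathType_eq_one (p := (hP.path a b).comp γ) fun t => by
    have := hle t
    rw [pathType_comp, hγ]
    change hP.disp a b t + _ = 1
    omega
  subst hc
  have := hle t
  have := hle s
  rw [← hP.pathType_eq_disp (γ := γ) ⟨s, by rw [hγ]; omega⟩, hγ]
  omega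

theorem isAdmissible_toPath {a b : Q} (e : a ⟶ b) :
    P.IsAdmissible (Quiver.Path.nil.cons e) := by
  have : Nontrivial (Fin (n + 1)) := Fin.nontrivial_iff_two_le.2 (by have := hP.pos; omega)
  obtain ⟨t, ht⟩ := exists_ne (P.type e)
  exact ⟨t, by simp [ht.symm]⟩

theorem disp_of_arrow {a b : Q} (e : a ⟶ b) (t : Fin (n + 1)) :
    hP.disp a b t = if P.type e = t then 1 else 0 := by
  rw [← hP.pathType_eq_disp (hP.isAdmissible_toPath e)]; simp

theorem neighbors_of_arrow {a b : Q} (e : a ⟶ b) : P.Neighbors a b := by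
  refine ⟨?_, _, hP.isAdmissible_toPath e, fun t => ?_⟩
  · rintro rfl
    simpa using hP.disp_of_arrow e (P.type e)
  · simp only [pathType_cons, pathType_nil]; split_ifs <;> simp

/-- For neighboring vertices `a` and `b`, exactly one of the circuits through `c → a → b` and
`c → b → a` is admissible. -/
theorem neighbors_cases {a b : Q} (h : P.Neighbors a b) (c : Q) :
    ((∀ t, hP.disp c a t + hP.disp a b t = hP.disp c b t) ∧
      (∀ t, hP.disp c b t + hP.disp b a t = hP.disp c a t + 1)) ∨
    ((∀ t, hP.disp c a t + hP.disp a b t = hP.disp c b t + 1) ∧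
      (∀ t, hP.disp c b t + hP.disp b a t = hP.disp c a t)) := by
  obtain ⟨m, hm⟩ := hP.exists_disp_add_disp c a b
  obtain ⟨m', hm'⟩ := hP.exists_disp_add_disp c b a
  have h1 := hP.disp_add_disp_eq_one h
  have : m + m' = 1 := by
    have := hm 0; have := hm' 0; have := h1 0
    omega
  obtain ⟨rfl, rfl⟩ | ⟨rfl, rfl⟩ : (m = 0 ∧ m' = 1) ∨ (m = 1 ∧ m' = 0) := by omega
  · exact Or.inl ⟨by simpa using hm, hm'⟩
  · exact Or.inr ⟨hm, by simpa using hm'⟩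

end IsZnStructure

end ArrowPartition

/-! ### Semisimple categories -/

namespace IsSemisimpleCategory

variable {C : Type u₂} [Category.{v₂} C] [Abelian C]

/-- The pullback of the epimorphism `e` along `f` maps onto `S`, so some simple summand of it maps
nontrivially to `S`. By Schur's lemma that map is invertible, and its inverse provides the lift. -/
theorem projective_of_simple (hC : IsSemisimpleCategory C) (S : C) [Simple S] : Projective S where
  factors {E X} f e _ := by
    obtain ⟨m, A, hA, ⟨i⟩⟩ := hC (pullback f e)
    obtain ⟨j, hj⟩ : ∃ j, biproduct.ι A j ≫ i.inv ≫ pullback.fst f e ≠ 0 := by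
      by_contra! h
      have h0 : i.inv ≫ pullback.fst f e = 0 := by
        ext j; simpa using h j
      have h1 : pullback.fst f e = 0 := by
        rw [← Iso.hom_inv_id_assoc i (pullback.fst f e), h0, comp_zero]
      exact id_nonzero S (by
        rw [← cancel_epi (pullback.fst f e), h1, zero_comp, zero_comp])
    have := hA j
    have := isIso_of_hom_simple hj
    refine ⟨inv (biproduct.ι A j ≫ i.inv ≫ pullback.fst f e) ≫ biproduct.ι A j ≫ i.inv ≫
      pullback.snd f e, ?_⟩
    rw [Category.assoc, IsIso.inv_comp_eq]
    simp [pullback.condition]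

theorem projective (hC : IsSemisimpleCategory C) (X : C) : Projective X := by
  obtain ⟨m, A, hA, ⟨i⟩⟩ := hC X
  have := fun j => (haveI := hA j; hC.projective_of_simple (A j))
  refine Projective.of_iso i.symm ⟨fun f e _ => ⟨biproduct.desc fun j =>
    Projective.factorThru (biproduct.ι A j ≫ f) e, ?_⟩⟩
  ext j
  simp

/-- Exactness in terms of generalized elements: every `T` is projective, so elements of the image
lift. -/
theorem exists_comp_eq (hC : IsSemisimpleCategory C) {X Y Z T : C} {f : X ⟶ Y} {g : Y ⟶ Z}
    (h : kernelSubobject g = imageSubobject f) {x : T ⟶ Y} (hx : x ≫ g = 0) :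
    ∃ y : T ⟶ X, y ≫ f = x := by
  have := hC.projective T
  have hf : (imageSubobject f).Factors x := h ▸ kernelSubobject_factors g x hx
  obtain ⟨z, hz⟩ : ∃ z, z ≫ factorThruImageSubobject f = (imageSubobject f).factorThru x hf :=
    ⟨_, Projective.factorThru_comp _ _⟩
  refine ⟨z, ?_⟩
  calc z ≫ f = z ≫ factorThruImageSubobject f ≫ (imageSubobject f).arrow := by
        rw [imageSubobject_arrow_comp]
    _ = x := by rw [← Category.assoc, hz, Subobject.factorThru_arrow]

/-- The image of a morphism has a complement. -/
theorem exists_complement (hC : IsSemisimpleCategory C) {X Y : C} (f : X ⟶ Y) :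
    ∃ (F : C) (s : F ⟶ Y) (q : Y ⟶ F), s ≫ q = 𝟙 F ∧ f ≫ q = 0 ∧
      ∀ {T : C} (y : T ⟶ Y), ∃ w : T ⟶ X, y = y ≫ q ≫ s + w ≫ f := by
  have := hC.projective (cokernel f)
  have hs : Projective.factorThru (𝟙 _) (cokernel.π f) ≫ cokernel.π f = 𝟙 _ :=
    Projective.factorThru_comp _ _
  refine ⟨cokernel f, Projective.factorThru (𝟙 _) (cokernel.π f), cokernel.π f, hs,
    cokernel.condition f, fun {T} y => ?_⟩
  have := hC.projective T
  have hex : (ShortComplex.mk f (cokernel.π f) (cokernel.condition f)).Exact :=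
    ShortComplex.exact_cokernel f
  -- Removing the component of `y` along the section leaves a map killed by the cokernel projection,
  -- which lifts through `f`.
  refine ⟨hex.liftFromProjective
    (y - y ≫ cokernel.π f ≫ Projective.factorThru (𝟙 _) (cokernel.π f)) ?_, ?_⟩
  · simp [Preadditive.sub_comp, hs]
  · have := hex.liftFromProjective_comp
      (y - y ≫ cokernel.π f ≫ Projective.factorThru (𝟙 _) (cokernel.π f))
      (by simp [Preadditive.sub_comp, hs])
    dsimp only at this
    rw [this]; abel

end IsSemisimpleCategory

/-! ### Maps of linked nets along admissible paths -/

namespace QuiverRep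

variable {Q : Type u₁} [Quiver.{v₁} Q] {C : Type u₂} [Category.{v₂} C]

theorem pathMap_comp (V : QuiverRep Q C) {a b c : Q} (p : Quiver.Path a b) (q : Quiver.Path b c) :
    V.pathMap (p.comp q) = V.pathMap p ≫ V.pathMap q :=
  V.map_comp (X := (Paths.of Q).obj a) (Y := (Paths.of Q).obj b) (Z := (Paths.of Q).obj c) p q

theorem pathMap_nil (V : QuiverRep Q C) (a : Q) :
    V.pathMap (Quiver.Path.nil : Quiver.Path a a) = 𝟙 (V.vertexObj a) :=
  V.map_id ((Paths.of Q).obj a)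

theorem pathMap_cons (V : QuiverRep Q C) {a b c : Q} (p : Quiver.Path a b) (e : b ⟶ c) :
    V.pathMap (p.cons e) = V.pathMap p ≫ V.pathMap (Quiver.Path.nil.cons e) :=
  V.pathMap_comp p (Quiver.Path.nil.cons e)

variable {n : ℕ} {P : ArrowPartition Q n}

/-- The map associated to the chosen admissible path between two vertices. -/
noncomputable def transport (V : QuiverRep Q C) (hP : P.IsZnStructure) (a b : Q) :
    V.vertexObj a ⟶ V.vertexObj b :=
  V.pathMap (hP.path a b)

@[simp]
theorem transport_self (V : QuiverRep Q C) (hP : P.IsZnStructure) (a : Q) :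
    V.transport hP a a = 𝟙 (V.vertexObj a) := by
  rw [transport, hP.path_self, pathMap_nil]

variable [Abelian C] {k : Type w} [Field k] [Linear k C] {V : QuiverRep Q C}

namespace IsWeaklyLinkedNet

theorem exists_pathMap_eq_smul (hV : V.IsWeaklyLinkedNet P k) (hP : P.IsZnStructure) {a b : Q}
    (γ : Quiver.Path a b) : ∃ c : k, V.pathMap γ = c • V.transport hP a b :=
  hV.smul_of_admissible γ _ (hP.isAdmissible_path a b)

theorem exists_ne_zero_pathMap_eq_smul (hV : V.IsWeaklyLinkedNet P k) (hP : P.IsZnStructure)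
    {a b : Q} {γ : Quiver.Path a b} (h : P.IsAdmissible γ) :
    ∃ c : k, c ≠ 0 ∧ V.pathMap γ = c • V.transport hP a b := by
  obtain ⟨c, hc⟩ := hV.exists_pathMap_eq_smul hP γ
  -- If the scalar is zero, both maps vanish, because each is a multiple of the other; then the
  -- scalar `1` serves.
  by_cases h0 : c = 0
  · obtain ⟨d, hd⟩ := hV.smul_of_admissible (hP.path a b) γ h
    refine ⟨1, one_ne_zero, ?_⟩
    rw [transport, hd, hc, h0]; simp
  · exact ⟨c, h0, hc⟩

/-- At the arrow where admissibility is first lost, the path before it may be replaced, up to a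
scalar, by one whose end forms a minimal circuit with that arrow. -/
theorem pathMap_eq_zero (hV : V.IsWeaklyLinkedNet P k) (hP : P.IsZnStructure) {a b : Q}
    {γ : Quiver.Path a b} (h : ¬ P.IsAdmissible γ) : V.pathMap γ = 0 := by
  induction γ with
  | nil => exact (h ⟨0, P.pathType_nil a 0⟩).elim
  | cons p e ih =>
    by_cases hp : P.IsAdmissible p
    · obtain ⟨ν, μ, h₁, h₂⟩ := hP.exists_circuit_of_cons e hp h
      have hadm : P.IsAdmissible (ν.comp μ) := hp.imp fun t ht => by
        rw [P.pathType_comp, ← h₁, ht]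
      obtain ⟨c, hc⟩ := hV.smul_of_admissible p _ hadm
      rw [pathMap_cons, hc, pathMap_comp, Linear.smul_comp, Category.assoc, ← pathMap_cons,
        hV.minimal_circuit _ (P.isMaximalSimplePath_of_pathType h₂), comp_zero, smul_zero]
    · rw [pathMap_cons, ih hp, zero_comp]

theorem transport_comp (hV : V.IsWeaklyLinkedNet P k) (hP : P.IsZnStructure) {a b c : Q}
    (h : ∀ t, hP.disp a b t + hP.disp b c t = hP.disp a c t) :
    ∃ d : k, d ≠ 0 ∧ V.transport hP a b ≫ V.transport hP b c = d • V.transport hP a c := by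
  rw [transport, transport, ← pathMap_comp]
  refine hV.exists_ne_zero_pathMap_eq_smul hP ?_
  obtain ⟨t, ht⟩ := hP.exists_disp_eq_zero a c
  exact ⟨t, by rw [P.pathType_comp]; exact (h t).trans ht⟩

theorem transport_comp_eq_zero (hV : V.IsWeaklyLinkedNet P k) (hP : P.IsZnStructure) {a b c : Q}
    (h : ∀ t, hP.disp a b t + hP.disp b c t ≠ 0) :
    V.transport hP a b ≫ V.transport hP b c = 0 := by
  rw [transport, transport, ← pathMap_comp]
  refine hV.pathMap_eq_zero hP ?_
  rintro ⟨t, ht⟩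
  exact h t (by rwa [P.pathType_comp] at ht)

end IsWeaklyLinkedNet

end QuiverRep

/-! ### Generators of an exact net along a polygon -/

namespace ArrowPartition.IsZnStructure

variable {Q : Type u₁} [Quiver.{v₁} Q] {n : ℕ} {P : ArrowPartition Q n}

/-- If the sum exceeded `disp a c`, then, as entries of `disp b c` are at most one and some entry is
zero, `b` would be strictly farther from `a` than `c` is. -/
theorem disp_add_disp_of_sum_le (hP : P.IsZnStructure) {a b c : Q} (hbc : b = c ∨ P.Neighbors b c)
    (h : ∑ t, hP.disp a b t ≤ ∑ t, hP.disp a c t) (t : Fin (n + 1)) :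
    hP.disp a b t + hP.disp b c t = hP.disp a c t := by
  obtain rfl | hbc := hbc
  · simp
  obtain ⟨m, hm⟩ := hP.exists_disp_add_disp a b c
  obtain rfl | hpos := Nat.eq_zero_or_pos m
  · exact hm t
  · exfalso
    obtain ⟨s, hs⟩ := hP.exists_disp_eq_zero b c
    have hle : ∀ t, hP.disp a c t ≤ hP.disp a b t := fun t => by
      have := hm t; have := hP.disp_le_one hbc t; omega
    have hlt : hP.disp a c s < hP.disp a b s := by have := hm s; omega
    exact absurd h (not_le.2 (Finset.sum_lt_sum (fun t _ => hle t) ⟨s, Finset.mem_univ s, hlt⟩))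

end ArrowPartition.IsZnStructure

namespace QuiverRep

variable {Q : Type u₁} [Quiver.{v₁} Q] {C : Type u₂} [Category.{v₂} C] [Abelian C]
  {n : ℕ} {P : ArrowPartition Q n}

open Classical in
/-- For each vertex of a finite set `H`, a complement in the associated object to the sum of the
images of the maps from the other vertices of `H`. -/
structure Complements (V : QuiverRep Q C) (hP : P.IsZnStructure) (H : Finset Q) where
  /-- The complement. -/
  obj : Q → C
  /-- The inclusion of the complement. -/
  ι : ∀ h, obj h ⟶ V.vertexObj h
  /-- The projection onto the complement. -/
  π : ∀ h, V.vertexObj h ⟶ obj h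
  ι_π : ∀ h, ι h ≫ π h = 𝟙 (obj h)
  transport_π : ∀ h, ∀ h' ∈ H, h' ≠ h → V.transport hP h' h ≫ π h = 0
  exists_eq : ∀ h {T : C} (y : T ⟶ V.vertexObj h), ∃ w : ∀ h', T ⟶ V.vertexObj h',
    y = y ≫ π h ≫ ι h + ∑ h' ∈ H with h' ≠ h, w h' ≫ V.transport hP h' h

open Classical in
theorem nonempty_complements (hC : IsSemisimpleCategory C) (V : QuiverRep Q C)
    (hP : P.IsZnStructure) (H : Finset Q) : Nonempty (V.Complements hP H) := by
  have key : ∀ h, ∃ (F : C) (s : F ⟶ V.vertexObj h) (q : V.vertexObj h ⟶ F), s ≫ q = 𝟙 F ∧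
      (∀ h' ∈ H, h' ≠ h → V.transport hP h' h ≫ q = 0) ∧
      ∀ {T : C} (y : T ⟶ V.vertexObj h), ∃ w : ∀ h', T ⟶ V.vertexObj h',
        y = y ≫ q ≫ s + ∑ h' ∈ H with h' ≠ h, w h' ≫ V.transport hP h' h := by
    intro h
    let I := (H.filter (· ≠ h) : Finset Q)
    let g : (⨁ fun i : I => V.vertexObj i.1) ⟶ V.vertexObj h :=
      biproduct.desc fun i => V.transport hP i.1 h
    obtain ⟨F, s, q, hsq, hgq, hw⟩ := hC.exists_complement g
    refine ⟨F, s, q, hsq, fun h' hH hne => ?_, fun {T} y => ?_⟩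
    · have := biproduct.ι (fun i : I => V.vertexObj i.1) ⟨h', Finset.mem_filter.2 ⟨hH, hne⟩⟩ ≫= hgq
      simpa [g] using this
    · obtain ⟨w, hw⟩ := hw y
      refine ⟨fun h' => if hh : h' ∈ I then w ≫ biproduct.π _ (⟨h', hh⟩ : I) else 0, ?_⟩
      rw [← Finset.sum_coe_sort]
      conv_lhs => rw [hw]
      congr 1
      have hwg : w ≫ g = (w ≫ 𝟙 _) ≫ g := by rw [Category.comp_id]
      have htot : ∑ i : I, biproduct.π (fun i : I => V.vertexObj i.1) i ≫
          biproduct.ι (fun i : I => V.vertexObj i.1) i = 𝟙 _ :=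
        IsBilimit.total (biproduct.isBilimit fun i : I => V.vertexObj i.1)
      rw [hwg, ← htot, Preadditive.comp_sum, Preadditive.sum_comp]
      refine Finset.sum_congr rfl fun i _ => ?_
      have hi : i.1 ∈ I := i.2
      simp [g, hi]
  choose F s q h₁ h₂ h₃ using key
  exact ⟨⟨F, s, q, h₁, h₂, h₃⟩⟩

/-! ### Spanning and independence of the transported complements -/

namespace Complements

variable {k : Type w} [Field k] [Linear k C] {V : QuiverRep Q C} {hP : P.IsZnStructure}
  {H : Finset Q}

/-- The sum over `H` of the maps to the object at a vertex given by maps to the complements. -/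
noncomputable def comb (D : V.Complements hP H) (k : Type w) [Field k] [Linear k C] (T : C) (v : Q) :
    (∀ h, T ⟶ D.obj h) →ₗ[k] (T ⟶ V.vertexObj v) :=
  ∑ h ∈ H, (Linear.rightComp k T (D.ι h ≫ V.transport hP h v)).comp (LinearMap.proj h)

theorem comb_apply (D : V.Complements hP H) {T : C} {v : Q} (f : ∀ h, T ⟶ D.obj h) :
    D.comb k T v f = ∑ h ∈ H, f h ≫ D.ι h ≫ V.transport hP h v := by
  simp [comb]

theorem comp_mem_range_comb (D : V.Complements hP H) {T : C} (v : Q) {h : Q} (hH : h ∈ H)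
    (f : T ⟶ D.obj h) :
    f ≫ D.ι h ≫ V.transport hP h v ∈ LinearMap.range (D.comb k T v) := by
  classical
  refine ⟨Pi.single h f, ?_⟩
  rw [comb_apply, Finset.sum_eq_single_of_mem h hH]
  · simp
  · intro b _ hb
    rw [Pi.single_eq_of_ne hb, zero_comp]

theorem transport_mem_range_comb (hV : V.IsWeaklyLinkedNet P k) (D : V.Complements hP H)
    {T : C} (v : Q) {h : Q} (hH : h ∈ H) (x : T ⟶ V.vertexObj h) :
    x ≫ V.transport hP h v ∈ LinearMap.range (D.comb k T v) := by
  classical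
  -- Induction on how far the length of `disp h v` lies below the sum of all such lengths over `H`,
  -- an upper bound for each of them.
  induction hs : (∑ h ∈ H, ∑ t, hP.disp h v t) - ∑ t, hP.disp h v t
    using Nat.strong_induction_on generalizing h with
  | _ s ih =>
    obtain ⟨w, hw⟩ := D.exists_eq h x
    rw [hw, Preadditive.add_comp, Preadditive.sum_comp, Category.assoc, Category.assoc,
      ← Category.assoc x]
    refine add_mem (D.comp_mem_range_comb v hH _) (sum_mem fun h' hh' => ?_)
    obtain ⟨hH', hne⟩ := Finset.mem_filter.1 hh'
    rw [Category.assoc]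
    obtain ⟨m, hm⟩ := hP.exists_disp_add_disp h' h v
    obtain rfl | hpos := Nat.eq_zero_or_pos m
    · obtain ⟨d, -, hd⟩ := hV.transport_comp hP (a := h') (b := h) (c := v) (by simpa using hm)
      rw [hd, Linear.comp_smul]
      refine Submodule.smul_mem _ d (ih _ ?_ hH' (w h') rfl)
      have h1 : ∑ t, hP.disp h' v t ≤ ∑ h ∈ H, ∑ t, hP.disp h v t :=
        Finset.single_le_sum (f := fun h => ∑ t, hP.disp h v t) (fun _ _ => Nat.zero_le _) hH'
      have h2 : ∑ t, hP.disp h v t < ∑ t, hP.disp h' v t := by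
        obtain ⟨t, ht⟩ : ∃ t, hP.disp h' h t ≠ 0 := by
          by_contra! h0; exact hne (hP.eq_of_disp_eq_zero h0)
        exact Finset.sum_lt_sum (fun t _ => by have := hm t; omega)
          ⟨t, Finset.mem_univ t, by have := hm t; omega⟩
      omega
    · rw [hV.transport_comp_eq_zero hP fun t => by have := hm t; omega, comp_zero]
      exact zero_mem _

theorem comb_surjective (hC : IsSemisimpleCategory C) (hV : V.IsWeaklyLinkedNet P k)
    (D : V.Complements hP H) (hgen : V.IsGeneratedBy (H : Set Q)) (T : C) (v : Q) :
    Function.Surjective (D.comb k T v) := by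
  intro y
  obtain ⟨m, a, γ, ha, hepi⟩ := hgen v
  have := hC.projective T
  obtain ⟨z, rfl⟩ : ∃ z, z ≫ biproduct.desc (f := fun i => V.vertexObj (a i))
      (fun i => V.pathMap (γ i)) = y := ⟨_, Projective.factorThru_comp y _⟩
  refine LinearMap.mem_range.1 ?_
  rw [← Category.comp_id z, ← biproduct.total, Preadditive.comp_sum, Preadditive.sum_comp]
  refine sum_mem fun i _ => ?_
  obtain ⟨c, hc⟩ := hV.exists_pathMap_eq_smul hP (γ i)
  rw [Category.assoc, Category.assoc, biproduct.ι_desc, hc, Linear.comp_smul, Linear.comp_smul,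
    ← Category.assoc]
  exact Submodule.smul_mem _ c (D.transport_mem_range_comb hV v (ha i) _)

/-- By exactness the kernel of `h → h'` is the image of `h' → h`, which the projection onto the
complement at `h` kills. -/
theorem eq_zero_of_comp_transport (hC : IsSemisimpleCategory C) (hexact : V.IsExactNet P)
    (D : V.Complements hP H) (hH : (H : Set Q).Pairwise P.Neighbors) {h h' : Q} (hh : h ∈ H)
    (hh' : h' ∈ H) {T : C} {f : T ⟶ D.obj h}
    (hf : f ≫ D.ι h ≫ V.transport hP h h' = 0) : f = 0 := by
  have hιπ : f = (f ≫ D.ι h) ≫ D.π h := by rw [Category.assoc, D.ι_π, Category.comp_id]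
  by_cases hne : h' = h
  · subst hne
    rw [transport_self, Category.comp_id] at hf
    rw [hιπ, hf, zero_comp]
  · obtain ⟨y, hy⟩ := hC.exists_comp_eq (hexact (hH hh hh' (Ne.symm hne)) _ _
      (hP.isAdmissible_path h h') (hP.isAdmissible_path h' h)) (x := f ≫ D.ι h)
      (by rw [Category.assoc]; exact hf)
    rw [hιπ, ← hy, Category.assoc]
    exact (y ≫= D.transport_π h h' hh' hne).trans comp_zero

theorem eq_zero_of_sum_eq_zero (hC : IsSemisimpleCategory C) (hV : V.IsWeaklyLinkedNet P k)
    (hexact : V.IsExactNet P) (D : V.Complements hP H)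
    (hH : (H : Set Q).Pairwise P.Neighbors) {v : Q} (hv : v ∈ H) {T : C}
    (f : ∀ h, T ⟶ D.obj h) (A : Finset Q) (hA : A ⊆ H)
    (hf : ∑ h ∈ A, f h ≫ D.ι h ≫ V.transport hP h v = 0) : ∀ h ∈ A, f h = 0 := by
  classical
  -- The polygon is ordered by distance from `v`, with `v` itself last: entries of displacements to
  -- neighbors are at most one, so other ranks are at most `n + 1`.
  let r : Q → ℕ := fun h => if h = v then n + 2 else ∑ t, hP.disp v h t
  have hnb : ∀ {x y}, x ∈ H → y ∈ H → x = y ∨ P.Neighbors x y := fun {x y} hx hy =>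
    or_iff_not_imp_left.2 fun hne => hH hx hy hne
  have hr : ∀ h ∈ H, h ≠ v → r h < r v := by
    intro h hh hne
    have : ∑ t, hP.disp v h t ≤ ∑ t : Fin (n + 1), 1 :=
      Finset.sum_le_sum fun t _ => hP.disp_le_one (hH hv hh (Ne.symm hne)) t
    simp [r, hne] at this ⊢
    omega
  induction A using Finset.induction_on_max_value r with
  | empty => simp
  | insert a A haA hmax ih =>
    rw [Finset.insert_subset_iff] at hA
    rw [Finset.sum_insert haA] at hf
    suffices hfa : f a = 0 by
      rw [hfa, zero_comp, zero_add] at hf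
      intro h hh
      obtain rfl | hh := Finset.mem_insert.1 hh
      · exact hfa
      · exact ih hA.2 hf h hh
    obtain rfl | hne := A.eq_empty_or_nonempty
    · rw [Finset.sum_empty, add_zero] at hf
      exact D.eq_zero_of_comp_transport hC hexact hH hA.1 hv hf
    obtain ⟨b, hb, hbmax⟩ := A.exists_max_image r hne
    have hab : a ≠ b := fun h => haA (h ▸ hb)
    have hbv : b ≠ v := by
      rintro rfl
      exact absurd (hmax b hb) (not_le.2 (hr a hA.1 hab))
    -- With `a` the last vertex and `b` the one before it, the map `v → b` kills everything coming
    -- from vertices up to `b`, while the contribution of `a` survives as a multiple of the map `a →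
    -- b`.
    have hkill : ∀ h ∈ A, V.transport hP h v ≫ V.transport hP v b = 0 := by
      intro h hh
      have hhv : h ≠ v := by
        rintro rfl
        exact absurd (hbmax h hh) (not_le.2 (hr b (hA.2 hb) hbv))
      have hle := hbmax h hh
      simp only [r, hhv, hbv, if_false] at hle
      have h1 := hP.disp_add_disp_of_sum_le (hnb (hA.2 hh) (hA.2 hb)) hle
      have h2 := hP.disp_add_disp_eq_one (hH (hA.2 hh) hv hhv)
      exact hV.transport_comp_eq_zero hP fun t => by
        have := h1 t; have := h2 t; omega
    have hsurv : ∀ t, hP.disp a v t + hP.disp v b t = hP.disp a b t := by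
      intro t
      by_cases hav : a = v
      · subst hav; simp
      have hle := hmax b hb
      simp only [r, hav, hbv, if_false] at hle
      have h1 := hP.disp_add_disp_of_sum_le (hnb (hA.2 hb) hA.1) hle t
      have h2 := hP.disp_add_disp_eq_one (hH hA.1 hv hav) t
      have h3 := hP.disp_add_disp_eq_one (hH hA.1 (hA.2 hb) hab) t
      omega
    obtain ⟨d, hd, hcomp⟩ := hV.transport_comp hP hsurv
    have := hf =≫ V.transport hP v b
    rw [Preadditive.add_comp, Preadditive.sum_comp, zero_comp, Finset.sum_eq_zero, add_zero] at this
    · simp only [Category.assoc, hcomp, Linear.comp_smul, smul_eq_zero, hd, false_or] at this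
      exact D.eq_zero_of_comp_transport hC hexact hH hA.1 (hA.2 hb) this
    · intro h hh
      simp only [Category.assoc, hkill h hh, comp_zero]

theorem comb_step (hC : IsSemisimpleCategory C) (hV : V.IsWeaklyLinkedNet P k)
    (hexact : V.IsExactNet P) (D : V.Complements hP H) {T : C} {v v' : Q}
    (hvv : P.Neighbors v v') (hsurj : Function.Surjective (D.comb k T v'))
    (hinj : ∀ f : ∀ h, T ⟶ D.obj h, D.comb k T v f = 0 → ∀ h ∈ H, f h = 0)
    (f : ∀ h, T ⟶ D.obj h) (hf : D.comb k T v' f = 0) : ∀ h ∈ H, f h = 0 := by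
  classical
  -- Vertices in `A` are those whose images survive `v → v'`; the images at `v'` of the others
  -- survive `v' → v`.
  let A : Q → Prop := fun h => ∀ t, hP.disp h v t + hP.disp v v' t = hP.disp h v' t
  have key : ∀ h, ∃ c : k, c ≠ 0 ∧
      (A h → V.transport hP h v ≫ V.transport hP v v' = c • V.transport hP h v' ∧
        V.transport hP h v' ≫ V.transport hP v' v = 0) ∧
      (¬ A h → V.transport hP h v ≫ V.transport hP v v' = 0 ∧
        V.transport hP h v' ≫ V.transport hP v' v = c • V.transport hP h v) := by
    intro h
    obtain ⟨h1, h2⟩ | ⟨h1, h2⟩ := hP.neighbors_cases hvv h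
    · obtain ⟨c, hc, hcomp⟩ := hV.transport_comp hP h1
      exact ⟨c, hc, fun _ => ⟨hcomp, hV.transport_comp_eq_zero hP fun t => by rw [h2]; omega⟩,
        fun hA => (hA h1).elim⟩
    · obtain ⟨c, hc, hcomp⟩ := hV.transport_comp hP h2
      exact ⟨c, hc, fun hA => by have := hA 0; have := h1 0; omega,
        fun _ => ⟨hV.transport_comp_eq_zero hP fun t => by rw [h1]; omega, hcomp⟩⟩
  choose c hc hcA hcB using key
  have hback : ∀ g : ∀ h, T ⟶ D.obj h, D.comb k T v' g ≫ V.transport hP v' v =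
      D.comb k T v fun h => if A h then 0 else c h • g h := by
    intro g
    rw [comb_apply, comb_apply, Preadditive.sum_comp]
    refine Finset.sum_congr rfl fun h _ => ?_
    by_cases hA : A h
    · simp [hA, (hcA h hA).2]
    · simp [hA, (hcB h hA).2]
  -- Pushing the relation back to `v` kills the terms in `A` and rescales the rest, so independence
  -- at `v` applies.
  have hB : ∀ h ∈ H, ¬ A h → f h = 0 := by
    intro h hh hA
    have := hinj _ ((hback f).symm.trans (by rw [hf, zero_comp])) h hh
    simpa [hA, hc h] using this
  -- The remaining terms lift to a kernel element at `v`. By exactness it comes from `v'`, so it is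
  -- also a combination of terms outside `A`; independence at `v` forces its coefficients to vanish.
  have hforth : D.comb k T v (fun h => if A h then (c h)⁻¹ • f h else 0) ≫
      V.transport hP v v' = 0 := by
    rw [← hf, comb_apply, comb_apply, Preadditive.sum_comp]
    refine Finset.sum_congr rfl fun h hh => ?_
    by_cases hA : A h
    · simp [hA, (hcA h hA).1, smul_smul, hc h]
    · simp [hA, hB h hh hA]
  obtain ⟨y, hy⟩ := hC.exists_comp_eq (hexact hvv _ _
    (hP.isAdmissible_path v v') (hP.isAdmissible_path v' v)) hforth
  obtain ⟨g, rfl⟩ := hsurj y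
  have hz := (hback g).symm.trans hy
  rw [← sub_eq_zero, ← map_sub] at hz
  intro h hh
  by_cases hA : A h
  · have := hinj _ hz h hh
    simpa [hA, hc h] using this
  · exact hB h hh hA

theorem eq_zero_of_comb_eq_zero (hC : IsSemisimpleCategory C) (hV : V.IsWeaklyLinkedNet P k)
    (hexact : V.IsExactNet P) (D : V.Complements hP H) (hH : P.IsPolygon (H : Set Q))
    (hgen : V.IsGeneratedBy (H : Set Q)) {T : C} {v : Q} (f : ∀ h, T ⟶ D.obj h)
    (hf : D.comb k T v f = 0) : ∀ h ∈ H, f h = 0 := by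
  obtain ⟨u, hu⟩ := hH.2.1
  suffices ∀ {v : Q} (_ : Quiver.Path u v) (f : ∀ h, T ⟶ D.obj h), D.comb k T v f = 0 →
      ∀ h ∈ H, f h = 0 from this (hP.path u v) f hf
  intro v γ
  induction γ with
  | nil =>
    intro f hf
    rw [comb_apply] at hf
    exact D.eq_zero_of_sum_eq_zero hC hV hexact hH.2.2 hu f H subset_rfl hf
  | cons p e ih =>
    exact D.comb_step hC hV hexact (hP.neighbors_of_arrow e)
      (D.comb_surjective hC hV hgen T _) ih

end Complements

end QuiverRep

/-! ### Nets with a constant associated object -/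

namespace QuiverRep

variable {Q : Type u₁} [Quiver.{v₁} Q] {C : Type u₂} [Category.{v₂} C] [Abelian C]
  {n : ℕ} {P : ArrowPartition Q n} {k : Type w} [Field k] [Linear k C]

/-- The representation associating an object `S` to all vertices and multiples of its identity to
the arrows. -/
def scalarRep (S : C) (c : ∀ a b : Q, (a ⟶ b) → k) : QuiverRep Q C :=
  Paths.lift { obj := fun _ => S, map := fun {a b} e => c a b e • 𝟙 S }

theorem scalarRep_pathMap_arrow (S : C) (c : ∀ a b : Q, (a ⟶ b) → k) {a b : Q} (e : a ⟶ b) :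
    (scalarRep S c).pathMap (Quiver.Path.nil.cons e) = c a b e • 𝟙 S :=
  Paths.lift_toPath _ e

/-- The scalar of an arrow is nonzero if and only if the arrow prolongs the admissible paths from
`h` to admissible paths. -/
def IsSupportedFrom (hP : P.IsZnStructure) (h : Q) (c : ∀ a b : Q, (a ⟶ b) → k) : Prop :=
  ∀ ⦃a b : Q⦄ (e : a ⟶ b), c a b e ≠ 0 ↔ ∀ t, hP.disp h a t + hP.disp a b t = hP.disp h b t

namespace IsSupportedFrom

variable {hP : P.IsZnStructure} {h : Q} {c : ∀ a b : Q, (a ⟶ b) → k}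

theorem exists_pathMap_eq (hc : IsSupportedFrom hP h c) (S : C) {a b : Q}
    (γ : Quiver.Path a b) :
    ∃ d : k, (scalarRep S c).pathMap γ = d • 𝟙 S ∧
      (d ≠ 0 ↔ ∀ t, hP.disp h a t + P.pathType γ t = hP.disp h b t) := by
  induction γ with
  | nil => exact ⟨1, by rw [pathMap_nil, one_smul]; rfl, by simp⟩
  | @cons b b' p e ih =>
    obtain ⟨d, hd, hd0⟩ := ih
    refine ⟨d * c b b' e, ?_, ?_⟩
    · rw [pathMap_cons, hd, scalarRep_pathMap_arrow]
      change (d • 𝟙 S) ≫ (c b b' e • 𝟙 S) = _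
      rw [Linear.smul_comp, Linear.comp_smul, Category.comp_id, smul_smul]
    · rw [mul_ne_zero_iff, hd0, hc e]
      obtain ⟨m, hm⟩ := hP.exists_pathType_eq_disp_add ((hP.path h a).comp p)
      obtain ⟨m', hm'⟩ := hP.exists_disp_add_disp h b b'
      have hm : ∀ t, hP.disp h a t + P.pathType p t = hP.disp h b t + m := fun t => by
        rw [← hm, P.pathType_comp]; rfl
      simp only [P.pathType_cons, ← hP.disp_of_arrow e]
      constructor
      · rintro ⟨h1, h2⟩ t
        rw [← add_assoc, h1, h2]
      · intro h1
        constructor <;>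
        · intro t
          have := h1 t; have := hm t; have := hm' t
          omega

/-- A path into `b` with nonzero scalar has type at most `disp h b`, which bounds its length. -/
theorem isLocallyFinite (hc : IsSupportedFrom hP h c) (S : C) :
    (scalarRep S c).IsLocallyFinite := by
  refine fun b => ⟨∑ t, hP.disp h b t, fun a γ hγ => ?_⟩
  obtain ⟨d, hd, hd0⟩ := hc.exists_pathMap_eq S γ
  by_cases h0 : d = 0
  · rw [hd, h0, zero_smul]; rfl
  · rw [← P.sum_pathType] at hγ
    exact absurd hγ (not_lt.2 (Finset.sum_le_sum fun t _ =>
      (hd0.1 h0 t) ▸ Nat.le_add_left _ _))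

theorem kernelSubobject_eq_bot {X Y : C} (f : X ⟶ Y) [Mono f] : kernelSubobject f = ⊥ :=
  Subobject.mk_eq_bot_iff_zero.2 (kernel.ι_of_mono f)

theorem kernelSubobject_eq_top {X Y : C} {f : X ⟶ Y} (hf : f = 0) : kernelSubobject f = ⊤ := by
  rw [hf, kernelSubobject_zero]

theorem imageSubobject_eq_bot {X Y : C} {f : X ⟶ Y} (hf : f = 0) : imageSubobject f = ⊥ := by
  rw [hf, imageSubobject_zero]

theorem isIso_pathMap {S : C} {a b : Q} {γ : Quiver.Path a b} {d : k} (hd0 : d ≠ 0)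
    (hd : (scalarRep S c).pathMap γ = d • 𝟙 S) : IsIso ((scalarRep S c).pathMap γ) := by
  have : IsIso (d • 𝟙 S) := ⟨d⁻¹ • 𝟙 S, by simp [smul_smul, hd0], by simp [smul_smul, hd0]⟩
  rw [hd]
  exact this

theorem isLinkedNet (hc : IsSupportedFrom hP h c) (S : C) :
    (scalarRep S c).IsLinkedNet P k where
  smul_of_admissible {a b} γ₁ γ₂ hγ₂ := by
    obtain ⟨d₁, hd₁, h₁⟩ := hc.exists_pathMap_eq S γ₁
    obtain ⟨d₂, hd₂, h₂⟩ := hc.exists_pathMap_eq S γ₂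
    rw [hd₁, hd₂]
    by_cases h0 : d₁ = 0
    · refine ⟨0, ?_⟩
      change d₁ • 𝟙 S = (0 : k) • d₂ • 𝟙 S
      rw [h0, zero_smul, zero_smul]
    · have hγ₁ : P.IsAdmissible γ₁ := (hP.exists_disp_eq_zero h b).imp fun t ht => by
        have := h₁.1 h0 t; omega
      have h2 : d₂ ≠ 0 := h₂.2 fun t => by rw [← h₁.1 h0 t, hP.pathType_eq hγ₁ hγ₂]
      refine ⟨d₁ * d₂⁻¹, ?_⟩
      change d₁ • 𝟙 S = (d₁ * d₂⁻¹) • d₂ • 𝟙 S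
      rw [smul_smul, mul_assoc, inv_mul_cancel₀ h2, mul_one]
  minimal_circuit {a b} γ hγ := by
    obtain ⟨d, hd, hd0⟩ := hc.exists_pathMap_eq S γ
    by_cases h0 : d = 0
    · rw [hd, h0, zero_smul]; rfl
    · obtain ⟨t, ht⟩ := hP.exists_disp_eq_zero h b
      have := hd0.1 h0 t
      have := hP.pathType_of_isMaximalSimplePath hγ t
      omega
  kernel_inf {a b b'} γ₁ γ₂ _ _ hdisj := by
    -- A path from `a` avoiding `t` still prolongs an admissible path from `h`, so acts invertibly;
    -- one of two paths with disjoint types avoids `t`.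
    obtain ⟨t, ht⟩ := hP.exists_disp_eq_zero h a
    have key : ∀ {b : Q} (γ : Quiver.Path a b), P.pathType γ t = 0 →
        kernelSubobject ((scalarRep S c).pathMap γ) = ⊥ := by
      intro b γ hγ
      obtain ⟨d, hd, hd0⟩ := hc.exists_pathMap_eq S γ
      obtain ⟨m, hm⟩ := hP.exists_pathType_eq_disp_add ((hP.path h a).comp γ)
      have hm : ∀ t, hP.disp h a t + P.pathType γ t = hP.disp h b t + m := fun t => by
        rw [← hm, P.pathType_comp]; rfl
      have := isIso_pathMap (hd0.2 fun s => by
        have := hm s; have := hm t; omega) hd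
      exact kernelSubobject_eq_bot _
    obtain h1 | h2 := hdisj t
    · rw [key γ₁ h1, bot_inf_eq]
    · rw [key γ₂ h2, inf_bot_eq]

theorem isExactNet (hc : IsSupportedFrom hP h c) (S : C) : (scalarRep S c).IsExactNet P := by
  intro a b hab γ μ hγ hμ
  obtain ⟨d₁, hd₁, h₁⟩ := hc.exists_pathMap_eq S γ
  obtain ⟨d₂, hd₂, h₂⟩ := hc.exists_pathMap_eq S μ
  simp only [hP.pathType_eq_disp hγ] at h₁
  simp only [hP.pathType_eq_disp hμ] at h₂
  -- Exactly one of the two directions is invertible, and the other is zero.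
  obtain ⟨h3, h4⟩ | ⟨h3, h4⟩ := hP.neighbors_cases hab h
  · have := isIso_pathMap (h₁.2 h3) hd₁
    have h0 : d₂ = 0 := by
      by_contra h0
      have := h₂.1 h0 0; have := h4 0; omega
    have hz : (scalarRep S c).pathMap μ = 0 := by rw [hd₂, h0, zero_smul]; rfl
    rw [kernelSubobject_eq_bot, imageSubobject_eq_bot hz]
  · have := isIso_pathMap (h₂.2 h4) hd₂
    have h0 : d₁ = 0 := by
      by_contra h0
      have := h₁.1 h0 0; have := h3 0; omega
    have hz : (scalarRep S c).pathMap γ = 0 := by rw [hd₁, h0, zero_smul]; rfl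
    rw [kernelSubobject_eq_top hz]
    have : Epi (image.ι ((scalarRep S c).pathMap μ)) := epi_image_of_epi _
    have : IsIso (image.ι ((scalarRep S c).pathMap μ)) :=
      isIso_of_mono_of_epi _
    exact (Subobject.mk_eq_top_of_isIso _).symm

end IsSupportedFrom

/-- The maps associated to arrows prolonging admissible paths from `h`, as multiples of the maps
associated to admissible paths. -/
theorem IsWeaklyLinkedNet.exists_isSupportedFrom {V : QuiverRep Q C}
    (hV : V.IsWeaklyLinkedNet P k) (hP : P.IsZnStructure) (h : Q) :
    ∃ c : ∀ a b : Q, (a ⟶ b) → k, IsSupportedFrom hP h c ∧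
      ∀ ⦃a b : Q⦄ (e : a ⟶ b), V.transport hP h a ≫ V.pathMap (Quiver.Path.nil.cons e) =
        c a b e • V.transport hP h b := by
  have key : ∀ (a b : Q) (e : a ⟶ b), ∃ d : k,
      (d ≠ 0 ↔ ∀ t, hP.disp h a t + hP.disp a b t = hP.disp h b t) ∧
      V.transport hP h a ≫ V.pathMap (Quiver.Path.nil.cons e) = d • V.transport hP h b := by
    intro a b e
    obtain ⟨d, hd, he⟩ := hV.exists_ne_zero_pathMap_eq_smul hP (hP.isAdmissible_toPath e)
    rw [he, Linear.comp_smul]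
    obtain ⟨h1, h2⟩ | ⟨h1, h2⟩ := hP.neighbors_cases (hP.neighbors_of_arrow e) h
    · obtain ⟨d', hd', he'⟩ := hV.transport_comp hP h1
      exact ⟨d * d', by simp [hd, hd', h1], by rw [he', smul_smul]⟩
    · refine ⟨0, by simpa using ⟨0, by rw [h1]; omega⟩, ?_⟩
      rw [hV.transport_comp_eq_zero hP fun t => by rw [h1]; omega, smul_zero, zero_smul]
  choose c hc₁ hc₂ using key
  exact ⟨c, hc₁, hc₂⟩

/-- A map to the object at a vertex `h` extends to a map of representations. -/
theorem exists_hom_of_scalarRep {V : QuiverRep Q C} {hP : P.IsZnStructure} {h : Q}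
    {c : ∀ a b : Q, (a ⟶ b) → k}
    (hc : ∀ ⦃a b : Q⦄ (e : a ⟶ b), V.transport hP h a ≫ V.pathMap (Quiver.Path.nil.cons e) =
        c a b e • V.transport hP h b) {S : C} (σ : S ⟶ V.vertexObj h) :
    ∃ η : scalarRep S c ⟶ V, ∀ v : Q, η.app v = σ ≫ V.transport hP h v := by
  have key : ∀ {a b : Q} (γ : Quiver.Path a b), ∃ d : k,
      (scalarRep S c).pathMap γ = d • 𝟙 S ∧
        V.transport hP h a ≫ V.pathMap γ = d • V.transport hP h b := by
    intro a b γ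
    induction γ with
    | nil => exact ⟨1, by rw [pathMap_nil, one_smul]; rfl, by
        rw [pathMap_nil, Category.comp_id, one_smul]⟩
    | @cons b b' p e ih =>
      obtain ⟨d, hd, hd'⟩ := ih
      refine ⟨d * c b b' e, ?_, ?_⟩
      · rw [pathMap_cons, hd, scalarRep_pathMap_arrow]
        change (d • 𝟙 S) ≫ (c b b' e • 𝟙 S) = _
        rw [Linear.smul_comp, Linear.comp_smul, Category.comp_id, smul_smul]
      · rw [pathMap_cons, ← Category.assoc, hd', Linear.smul_comp, hc e, smul_smul]
  refine ⟨⟨fun v => σ ≫ V.transport hP h v, fun a b γ => ?_⟩, fun v => rfl⟩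
  obtain ⟨d, hd, hd'⟩ := key γ
  refine (congrArg (fun x : S ⟶ S => x ≫ σ ≫ V.transport hP h b) hd).trans ?_
  refine Eq.trans ?_ (Category.assoc σ (V.transport hP h a) (V.pathMap γ)).symm
  simp [hd']

/-- A net in a semisimple category generated by a polygon is, at each vertex, the direct sum of the
images of finitely many simple objects. -/
theorem exists_simple_generators (hC : IsSemisimpleCategory C) (hP : P.IsZnStructure)
    {V : QuiverRep Q C} (hV : V.IsWeaklyLinkedNet P k) (hexact : V.IsExactNet P) {H : Set Q}
    (hH : P.IsPolygon H) (hgen : V.IsGeneratedBy H) :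
    ∃ (m : ℕ) (h : Fin m → Q) (S : Fin m → C) (σ : ∀ i, S i ⟶ V.vertexObj (h i)),
      (∀ i, Simple (S i)) ∧ ∀ (v : Q) (T : C), Function.Bijective
        fun x : ∀ i, T ⟶ S i => ∑ i, x i ≫ σ i ≫ V.transport hP (h i) v := by
  classical
  obtain ⟨H, rfl⟩ := hH.1.exists_finset_coe
  obtain ⟨D⟩ := nonempty_complements hC V hP H
  choose m A hA hiso using fun h => hC (D.obj h)
  let i := fun h => (hiso h).some
  let J := Σ h : H, Fin (m h)
  let e : Fin (Fintype.card J) ≃ J := (Fintype.equivFin J).symm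
  refine ⟨Fintype.card J, fun l => (e l).1, fun l => A (e l).1 (e l).2,
    fun l => biproduct.ι (A (e l).1) (e l).2 ≫ (i (e l).1).inv ≫ D.ι (e l).1,
    fun l => hA _ _, fun v T => ?_⟩
  -- Maps to the simple summands are assembled into maps to the complements; the value `0` off `H`
  -- is immaterial, since `comb` sums over `H` only.
  let F : (∀ j : J, T ⟶ A j.1 j.2) → ∀ h, T ⟶ D.obj h := fun x h =>
    if hh : h ∈ H then (∑ l, x ⟨⟨h, hh⟩, l⟩ ≫ biproduct.ι (A h) l) ≫ (i h).inv else 0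
  have hF : ∀ x : ∀ j : J, T ⟶ A j.1 j.2, ∑ j : J, x j ≫ (biproduct.ι (A j.1) j.2 ≫
      (i j.1).inv ≫ D.ι j.1) ≫ V.transport hP j.1 v = D.comb k T v (F x) := by
    intro x
    rw [D.comb_apply, Fintype.sum_sigma, ← Finset.sum_coe_sort H]
    refine Finset.sum_congr rfl fun h _ => ?_
    simp [F, Preadditive.sum_comp]
  let E : (∀ l, T ⟶ A (e l).1 (e l).2) ≃ (∀ j : J, T ⟶ A j.1 j.2) :=
    e.piCongrLeft fun j : J => T ⟶ A j.1 j.2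
  have hE : ∀ y : ∀ j : J, T ⟶ A j.1 j.2, (∑ l, y (e l) ≫ (biproduct.ι (A (e l).1) (e l).2 ≫
      (i (e l).1).inv ≫ D.ι (e l).1) ≫ V.transport hP (e l).1 v) = D.comb k T v (F y) := by
    intro y
    rw [← hF]
    exact Equiv.sum_comp e fun j : J => y j ≫ (biproduct.ι (A j.1) j.2 ≫
      (i j.1).inv ≫ D.ι j.1) ≫ V.transport hP j.1 v
  suffices hbij : Function.Bijective fun y : ∀ j : J, T ⟶ A j.1 j.2 => D.comb k T v (F y) by
    have := hbij.comp E.bijective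
    convert this using 1
    funext x
    obtain ⟨y, rfl⟩ := E.symm.surjective x
    simp only [Function.comp_apply, Equiv.apply_symm_apply]
    exact hE y
  have hFπ : ∀ (x : ∀ j : J, T ⟶ A j.1 j.2) (j : J),
      F x j.1 ≫ (i j.1).hom ≫ biproduct.π (A j.1) j.2 = x j := by
    rintro x ⟨⟨h, hh⟩, l⟩
    simp only [F, hh, dif_pos, Category.assoc, Iso.inv_hom_id_assoc, Preadditive.sum_comp]
    rw [Finset.sum_eq_single_of_mem l (Finset.mem_univ l)]
    · simp
    · intro b _ hb
      simp [biproduct.ι_π_ne _ hb]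
  constructor
  · intro x y hxy
    have hz : D.comb k T v (F x - F y) = 0 := by
      rw [map_sub, sub_eq_zero]; exact hxy
    have := D.eq_zero_of_comb_eq_zero hC hV hexact hH hgen _ hz
    funext j
    rw [← hFπ x j, ← hFπ y j, sub_eq_zero.1 (this j.1 j.1.2)]
  · intro y
    obtain ⟨f, rfl⟩ := D.comb_surjective hC hV hgen T v y
    refine ⟨fun j => f j.1 ≫ (i j.1).hom ≫ biproduct.π (A j.1) j.2, ?_⟩
    dsimp only
    rw [D.comb_apply, D.comb_apply]
    refine Finset.sum_congr rfl fun h hh => ?_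
    have hsum : ∑ l, (f h ≫ (i h).hom ≫ biproduct.π (A h) l) ≫ biproduct.ι (A h) l =
        f h ≫ (i h).hom := by
      rw [← Category.comp_id (f h ≫ (i h).hom), ← biproduct.total, Preadditive.comp_sum]
      simp only [Category.assoc]
    simp only [F, hh, dif_pos]
    rw [hsum]
    simp only [Category.assoc, Iso.hom_inv_id_assoc]

/-- A map from a finite direct sum of representations is an isomorphism if it induces bijections
on maps from all objects at each vertex. -/
theorem isIso_biproduct_desc {m : ℕ} {V : QuiverRep Q C} {W : Fin m → QuiverRep Q C}
    (η : ∀ i, W i ⟶ V)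
    (hη : ∀ (v : Q) (T : C), Function.Bijective
      fun x : ∀ i, T ⟶ (W i).obj v => ∑ i, x i ≫ (η i).app v) :
    IsIso (biproduct.desc η) := by
  rw [NatTrans.isIso_iff_isIso_app]
  intro v
  refine isIso_of_yoneda_map_bijective _ fun T => ?_
  have htot : ∑ i, (biproduct.π W i).app v ≫ (biproduct.ι W i).app v = 𝟙 _ := by
    simp only [← NatTrans.comp_app, ← NatTrans.app_sum, biproduct.total, NatTrans.id_app]
  have hdesc : ∀ i, (biproduct.ι W i).app v ≫ (biproduct.desc η).app v = (η i).app v := fun i => by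
    rw [← NatTrans.comp_app, biproduct.ι_desc]
  have hcomp : ∀ x : T ⟶ (⨁ W).obj v, x ≫ (biproduct.desc η).app v =
      ∑ i, (x ≫ (biproduct.π W i).app v) ≫ (η i).app v := by
    intro x
    conv_lhs => rw [← Category.id_comp ((biproduct.desc η).app v), ← htot]
    simp only [Preadditive.sum_comp, Preadditive.comp_sum, Category.assoc, hdesc]
  constructor
  · intro x y hxy
    dsimp only at hxy
    rw [hcomp, hcomp] at hxy
    have := (hη v T).1 hxy
    rw [← Category.comp_id x, ← Category.comp_id y, ← htot, Preadditive.comp_sum,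
      Preadditive.comp_sum]
    refine Finset.sum_congr rfl fun i _ => ?_
    rw [← Category.assoc, ← Category.assoc, congrFun this i]
  · intro z
    obtain ⟨x, rfl⟩ := (hη v T).2 z
    refine ⟨∑ i, x i ≫ (biproduct.ι W i).app v, ?_⟩
    simp only [Preadditive.sum_comp, Category.assoc, hdesc]

end QuiverRep

theorem mainTheorem4 {k : Type w} [Field k] {C : Type u₂} [Category.{v₂} C] [Abelian C]
    [Linear k C] (hC : IsSemisimpleCategory C)
    {Q : Type u₁} [Quiver.{v₁} Q] {n : ℕ} (P : ArrowPartition Q n) (hP : P.IsZnStructure)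
    (V : QuiverRep Q C) (hV : V.IsLinkedNet P k) (hexact : V.IsExactNet P)
    (H : Set Q) (hH : P.IsPolygon H) (hgen : V.IsGeneratedBy H) :
    ∃ (m : ℕ) (W : Fin m → QuiverRep Q C),
      (∀ i, (W i).IsSimpleRep ∧ (W i).IsLocallyFinite ∧
        (W i).IsLinkedNet P k ∧ (W i).IsExactNet P) ∧
      Nonempty (V ≅ ⨁ W) := by
  obtain ⟨m, h, S, σ, hS, hbij⟩ :=
    QuiverRep.exists_simple_generators hC hP hV.toIsWeaklyLinkedNet hexact hH hgen
  choose c hc₁ hc₂ using fun i => hV.toIsWeaklyLinkedNet.exists_isSupportedFrom hP (h i)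
  choose η hη using fun i => QuiverRep.exists_hom_of_scalarRep (hc₂ i) (σ i)
  refine ⟨m, fun i => QuiverRep.scalarRep (S i) (c i), fun i => ⟨fun _ => hS i,
    (hc₁ i).isLocallyFinite _, (hc₁ i).isLinkedNet _, (hc₁ i).isExactNet _⟩, ?_⟩
  have := QuiverRep.isIso_biproduct_desc η fun v T => by
    simp only [hη]
    exact hbij v T
  exact ⟨(asIso (biproduct.desc η)).symm⟩
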